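/- **Pure proof nets.** A (pure) net is a finite graph with edges directed from the node that emits them to the node that consumes them, and with nodes of the following kinds: $P$ (emits one edge, a premise of the net), $C$ (consumes one edge, the conclusion of the net), $W$ (consumes one edge), $X$ (consumes one, emits two), $D$ and $N$ (consume one, emit one), $R_\multimap$ (emits a bound premise $x$ and a function $f$, consumes a body $b$), $L_\multimap$ (consumes a function $f$ and an argument $a$, emits a result $r$), $R_\otimes$ (consumes $a,b$, emits $o$), $L_\otimes$ (consumes $i$, emits $x,y$), and boxes: a box contains a net, in which each $P$ is replaced by a node $L_!$ and $C$ is replaced by a node $R_!$; each $L_!$ consumes an edge from outside (an auxiliary edge), and $R_!$ emits an edge to the outside (the principal edge). Pure proof nets are the nets, each with any finite number of premises and one conclusion, generated inductively by: a single wire from $P$ to $C$; composition (the conclusion of one proof net plugged into a premise of another); adding a $W$ with a new premise; joining two premises by an $X$ or by an $L_\otimes$; prefixing a premise by a $D$ or by an $N$; binding a premise and the conclusion by an $R_\multimap$; joining the conclusion of one proof net and a premise of another by an $L_\multimap$; joining the conclusions of two proof nets by an $R_\otimes$; putting a proof net in a box. The level of a node is the number of boxes that contain it; $|G|$ is the number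 of nodes of $G$ at all levels, and the depth $\partial(G)$ is the greatest level of a node of $G$. **Superlazy reduction.** Give a node $X$ or $W$ the cost $0$, $D$ the cost $-1$, and $N$ the cost $+1$. A derelicting tree is a tree $t$ of nodes $X,D,N,W$, containing both successors of each of its $X$-nodes, whose leaves are $D$- or $W$-nodes, such that the path from the root to any $D$-leaf has total cost $-1$ and every other path that starts at the root has nonnegative cost (both ends included). The following steps act on nodes at level $0$ only. * $\leadsto_\multimap$: an $R_\multimap$ whose function edge is consumed by an $L_\multimap$; both nodes are removed, $a$ is connected to $x$ and $b$ to $r$. * $\leadsto_\otimes$: an $R_\otimes$ whose output is consumed by an $L_\otimes$; both nodes are removed, $a$ is connected to $x$ and $b$ to $y$. * $\leadsto_M$: a box whose principal edge is an auxiliary edge of a second box; the two are merged into one box that contains the composition of their contents. * $\leadsto_{XNDW}$: a box with content $K$ whose principal edge enters the root of a derelicting tree $t$. The box and $t$ are replaced by one copy of $K$ for each $D$-leaf of $t$ and one copy of $t$ for each premise of $K$: the conclusion of the $j$-th copy of $K$ takes the place of the output of the $j$-th $D$-leaf; the $i$-th copy of $t$ has its root at the $i$-th auxiliary edge of the box,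 and its $j$-th $D$-leaf is connected to the $i$-th premise of the $j$-th copy of $K$. The relation $\hookrightarrow$ is the union of these steps, where $\leadsto_M$ may only be applied to nets all of whose redexes are $\leadsto_M$ redexes; $G\hookrightarrow^kH$ denotes a sequence of $k$ steps. As long as no $\leadsto_M$ step is made, each box of a reduct is a residual of exactly one box of $G$ (a box that is not touched by a step, and each copy of a box inside a copied content, is a residual of the box it comes from). **Box reductions.** A sequence $G\hookrightarrow^kH$ is an $(n,d)$-box reduction if it has no $\leadsto_M$ step and there are $r\le n$ boxes $b_1,\dots,b_r$ at level $0$ in $G$, with contents $J_1,\dots,J_r$, such that $\partial(J_i)<d$ for all $i$, and the box involved in any $\leadsto_{XNDW}$ step of the sequence is a residual of one of $b_1,\dots,b_r$ or of a box that occurs (at any level) in one of $J_1,\dots,J_r$. **Bounding functions.** For $d\in\mathbb N$ define $f_d:\mathbb N\times\mathbb N\to\mathbb N$ by $$f_0(n,m)=m,\qquad f_{d+1}(0,m)=m,$$ $$f_{d+1}(n+1,m)=1+f_{d+1}(n,m)+f_d\bigl((2m+1)f_{d+1}(n,m),\,(2m+1)f_{d+1}(n,m)\bigr).$$ **Proposition.**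 Every $f_d$ is primitive recursive. For every pure proof net $G$ and all $n,d,k\in\mathbb N$: if $G\hookrightarrow^kH$ is an $(n,d)$-box reduction sequence with $k$ steps, then $k\le f_d(n,|G|)$ and $|H|\le f_d(n,|G|)$. -/

import Mathlib

namespace PureNet

/-! ### Pure proof nets

A net is a graph whose edges are directed from the node that emits them to the node that consumes
them.  Edges are named by natural numbers ("wires").  The nodes at level `0` are listed as cells;
a box is one cell that carries the net inside it, whose wires are local to the box. -/

abbrev Wire := ℕ

/-- The nodes of a net other than `P` and `C`.  A box cell `box b ps c cs as o` is a box named `b`: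
inside it lies the net with premises `ps`, conclusion `c` and cells `cs`; its `i`-th `L!`-node
consumes the `i`-th wire of `as` outside and emits the `i`-th wire of `ps` inside, and its `R!`-node
consumes `c` inside and emits `o` outside.  Names serve to follow boxes along a reduction. -/
inductive Cell where
  /-- `W`, consumes `i`. -/
  | weak (i : Wire)
  /-- `X`, consumes `i`, emits `o₁` and `o₂`. -/
  | contr (i o₁ o₂ : Wire)
  /-- `D`, consumes `i`, emits `o`. -/
  | der (i o : Wire)
  /-- `N`, consumes `i`, emits `o`. -/
  | dig (i o : Wire)
  /-- `R⊸`, emits the bound premise `x` and the function `f`, consumes the body `b`. -/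
  | lolR (x b f : Wire)
  /-- `L⊸`, consumes the function `f` and the argument `a`, emits the result `r`. -/
  | lolL (f a r : Wire)
  /-- `R⊗`, consumes `a` and `b`, emits `o`. -/
  | tenR (a b o : Wire)
  /-- `L⊗`, consumes `i`, emits `x` and `y`. -/
  | tenL (i x y : Wire)
  | box (name : ℕ) (prems : List Wire) (concl : Wire) (cells : List Cell)
      (aux : List Wire) (out : Wire)

/-- A net: every wire of `prems` is emitted by a `P`-node, and `concl` is consumed by the
`C`-node. -/
structure Net where
  prems : List Wire
  concl : Wire
  cells : List Cell

namespace Cell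

/-- The wires attached to a cell at its own level. -/
def wires : Cell → List Wire
  | weak i => [i]
  | contr i o₁ o₂ => [i, o₁, o₂]
  | der i o => [i, o]
  | dig i o => [i, o]
  | lolR x b f => [x, b, f]
  | lolL f a r => [f, a, r]
  | tenR a b o => [a, b, o]
  | tenL i x y => [i, x, y]
  | box _ _ _ _ aux out => out :: aux

/-- Renaming of the wires attached to a cell at its own level. -/
def rename (σ : Wire → Wire) : Cell → Cell
  | weak i => weak (σ i)
  | contr i o₁ o₂ => contr (σ i) (σ o₁) (σ o₂)
  | der i o => der (σ i) (σ o)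
  | dig i o => dig (σ i) (σ o)
  | lolR x b f => lolR (σ x) (σ b) (σ f)
  | lolL f a r => lolL (σ f) (σ a) (σ r)
  | tenR a b o => tenR (σ a) (σ b) (σ o)
  | tenL i x y => tenL (σ i) (σ x) (σ y)
  | box n ps c cs aux out => box n ps c cs (aux.map σ) (σ out)

mutual

/-- The number of nodes of a cell, at all levels.  For a box: one `L!` for each premise, one `R!`,
and the nodes of the cells inside. -/
def size : Cell → ℕ
  | box _ ps _ cs _ _ => ps.length + 1 + sizeList cs
  | _ => 1

def sizeList : List Cell → ℕ
  | [] => 0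
  | c :: cs => c.size + sizeList cs

end

mutual

/-- The greatest number of nested boxes in a cell. -/
def depth : Cell → ℕ
  | box _ _ _ cs _ _ => depthList cs + 1
  | _ => 0

def depthList : List Cell → ℕ
  | [] => 0
  | c :: cs => max c.depth (depthList cs)

end

mutual

/-- The names of all boxes in a cell, at all levels and with multiplicity. -/
def boxNames : Cell → List ℕ
  | box b _ _ cs _ _ => b :: boxNamesList cs
  | _ => []

def boxNamesList : List Cell → List ℕ
  | [] => []
  | c :: cs => c.boxNames ++ boxNamesList cs

end

end Cell

namespace Net

/-- The wires of a net at level `0`. -/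
def wires (G : Net) : List Wire := G.concl :: (G.prems ++ G.cells.flatMap Cell.wires)

def rename (σ : Wire → Wire) (G : Net) : Net :=
  ⟨G.prems.map σ, σ G.concl, G.cells.map (Cell.rename σ)⟩

/-- The size `|G|`: the number of nodes of `G` at all levels, `P`- and `C`-nodes included. -/
def size (G : Net) : ℕ := G.prems.length + 1 + Cell.sizeList G.cells

/-- The depth `∂(G)`: the greatest level of a node of `G`, where the level of a node is the number
of boxes that contain it. -/
def depth (G : Net) : ℕ := Cell.depthList G.cells

/-- The names of all boxes of `G`, at all levels and with multiplicity. -/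
def boxNames (G : Net) : List ℕ := Cell.boxNamesList G.cells

/-- `b` is the name of a box at level `0` of `G`, and `K` is the net inside that box. -/
def HasBox (G : Net) (b : ℕ) (K : Net) : Prop :=
  ∃ aux out, Cell.box b K.prems K.concl K.cells aux out ∈ G.cells

end Net

/-- The nets `G` and `F` have no common wire at level `0`. -/
def Apart (G F : Net) : Prop := ∀ w, w ∈ G.wires → w ∉ F.wires

/-- Pure proof nets.  The order in which premises and cells are listed is immaterial. -/
inductive IsProofNet : Net → Prop where
  | wire (w : Wire) : IsProofNet ⟨[w], w, []⟩
  | perm {Γ Δ : List Wire} {c : Wire} {cs ds : List Cell} :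
      IsProofNet ⟨Γ, c, cs⟩ → Γ.Perm Δ → cs.Perm ds → IsProofNet ⟨Δ, c, ds⟩
  | cut {Γ Δ : List Wire} {a c : Wire} {cs ds : List Cell} :
      IsProofNet ⟨Γ, a, cs⟩ → IsProofNet ⟨a :: Δ, c, ds⟩ →
      (∀ w, w ∈ Net.wires ⟨Γ, a, cs⟩ → w ∈ Net.wires ⟨a :: Δ, c, ds⟩ → w = a) →
      IsProofNet ⟨Γ ++ Δ, c, cs ++ ds⟩
  | weak {Γ : List Wire} {c i : Wire} {cs : List Cell} :
      IsProofNet ⟨Γ, c, cs⟩ → i ∉ Net.wires ⟨Γ, c, cs⟩ →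
      IsProofNet ⟨i :: Γ, c, .weak i :: cs⟩
  | contr {Γ : List Wire} {c i x y : Wire} {cs : List Cell} :
      IsProofNet ⟨x :: y :: Γ, c, cs⟩ → i ∉ Net.wires ⟨x :: y :: Γ, c, cs⟩ →
      IsProofNet ⟨i :: Γ, c, .contr i x y :: cs⟩
  | der {Γ : List Wire} {c i x : Wire} {cs : List Cell} :
      IsProofNet ⟨x :: Γ, c, cs⟩ → i ∉ Net.wires ⟨x :: Γ, c, cs⟩ →
      IsProofNet ⟨i :: Γ, c, .der i x :: cs⟩
  | dig {Γ : List Wire} {c i x : Wire} {cs : List Cell} :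
      IsProofNet ⟨x :: Γ, c, cs⟩ → i ∉ Net.wires ⟨x :: Γ, c, cs⟩ →
      IsProofNet ⟨i :: Γ, c, .dig i x :: cs⟩
  | lolR {Γ : List Wire} {x b f : Wire} {cs : List Cell} :
      IsProofNet ⟨x :: Γ, b, cs⟩ → f ∉ Net.wires ⟨x :: Γ, b, cs⟩ →
      IsProofNet ⟨Γ, f, .lolR x b f :: cs⟩
  | lolL {Γ Δ : List Wire} {a r c f : Wire} {cs ds : List Cell} :
      IsProofNet ⟨Γ, a, cs⟩ → IsProofNet ⟨r :: Δ, c, ds⟩ →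
      Apart ⟨Γ, a, cs⟩ ⟨r :: Δ, c, ds⟩ →
      f ∉ Net.wires ⟨Γ, a, cs⟩ → f ∉ Net.wires ⟨r :: Δ, c, ds⟩ →
      IsProofNet ⟨f :: (Γ ++ Δ), c, .lolL f a r :: (cs ++ ds)⟩
  | tenR {Γ Δ : List Wire} {a b o : Wire} {cs ds : List Cell} :
      IsProofNet ⟨Γ, a, cs⟩ → IsProofNet ⟨Δ, b, ds⟩ →
      Apart ⟨Γ, a, cs⟩ ⟨Δ, b, ds⟩ →
      o ∉ Net.wires ⟨Γ, a, cs⟩ → o ∉ Net.wires ⟨Δ, b, ds⟩ →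
      IsProofNet ⟨Γ ++ Δ, o, .tenR a b o :: (cs ++ ds)⟩
  | tenL {Γ : List Wire} {c i x y : Wire} {cs : List Cell} :
      IsProofNet ⟨x :: y :: Γ, c, cs⟩ → i ∉ Net.wires ⟨x :: y :: Γ, c, cs⟩ →
      IsProofNet ⟨i :: Γ, c, .tenL i x y :: cs⟩
  | box {Γ : List Wire} {c : Wire} {cs : List Cell} (name : ℕ) {aux : List Wire} {out : Wire} :
      IsProofNet ⟨Γ, c, cs⟩ → aux.length = Γ.length → aux.Nodup → out ∉ aux →
      IsProofNet ⟨aux, out, [.box name Γ c cs aux out]⟩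

/-! ### Derelicting trees -/

/-- Trees of `X`, `D`, `N`, `W` nodes whose leaves are `W`- or `D`-nodes.  The first argument is
the wire consumed by the root; the wire emitted by a `D`-leaf leaves the tree. -/
inductive Tree where
  | weak (i : Wire)
  | derLeaf (i o : Wire)
  | der (i : Wire) (t : Tree)
  | dig (i : Wire) (t : Tree)
  | contr (i : Wire) (t s : Tree)

namespace Tree

/-- The wire consumed by the root. -/
def root : Tree → Wire
  | weak i => i
  | derLeaf i _ => i
  | der i _ => i
  | dig i _ => i
  | contr i _ _ => i

/-- The nodes of the tree. -/
def cells : Tree → List Cell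
  | weak i => [.weak i]
  | derLeaf i o => [.der i o]
  | der i t => .der i t.root :: t.cells
  | dig i t => .dig i t.root :: t.cells
  | contr i t s => .contr i t.root s.root :: (t.cells ++ s.cells)

/-- The wires emitted by the `D`-leaves. -/
def leaves : Tree → List Wire
  | weak _ => []
  | derLeaf _ o => [o]
  | der _ t => t.leaves
  | dig _ t => t.leaves
  | contr _ t s => t.leaves ++ s.leaves

/-- `w` is a wire between two nodes of the tree. -/
def IsInner (t : Tree) (w : Wire) : Prop :=
  w ∈ t.cells.flatMap Cell.wires ∧ w ≠ t.root ∧ w ∉ t.leaves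

/-- The conditions on costs for a subtree, where `z` is the sum of the costs of the nodes above it
(`X` and `W` cost `0`, `D` costs `-1`, `N` costs `1`): a path that ends in a `D`-leaf has cost `-1`,
every other path has nonnegative cost. -/
def CostOK (z : ℤ) : Tree → Prop
  | weak _ => 0 ≤ z
  | derLeaf _ _ => z - 1 = -1
  | der _ t => 0 ≤ z - 1 ∧ CostOK (z - 1) t
  | dig _ t => 0 ≤ z + 1 ∧ CostOK (z + 1) t
  | contr _ t s => 0 ≤ z ∧ CostOK z t ∧ CostOK z s

def IsDerelicting (t : Tree) : Prop := CostOK 0 t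

end Tree

/-! ### Superlazy reduction -/

/-- The wire identifications made by the step `⊸`: the argument `a` is plugged into the bound
premise `x`, and the body `b` into the result `r`. -/
def lolSubst (x b a r : Wire) (w : Wire) : Wire :=
  if w = r then (if b = x then a else b) else if w = x then a else w

/-- The wire identifications made by the step `⊗`. -/
def tenSubst (a b x y : Wire) (w : Wire) : Wire :=
  if w = x then a else if w = y then b else w

/-- `ρ j` names the wires of the `j`-th copy of the content `K` of a box of `F`, and `τ i` those of
the `i`-th copy of the derelicting tree `t` that faces the box; `aux` are the wires consumed by the
auxiliary doors `L!` of the box.  The conclusion of the `j`-th copy of `K` is plugged where the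
`j`-th `D`-leaf was plugged, the `i`-th copy of `t` has its root plugged into the `i`-th wire of
`aux`, and its `j`-th `D`-leaf is plugged into the `i`-th premise of the `j`-th copy of `K`.  All
other wires of the copies are fresh and pairwise distinct. -/
structure Copying (F K : Net) (t : Tree) (aux : List Wire) (ρ τ : ℕ → Wire → Wire) : Prop where
  concl : ∀ j l, t.leaves[j]? = some l → ρ j K.concl = l
  root : ∀ i a, aux[i]? = some a → τ i t.root = a
  leaf : ∀ i j p l, K.prems[i]? = some p → t.leaves[j]? = some l → τ i l = ρ j p
  freshContent : ∀ j < t.leaves.length, ∀ w ∈ K.wires, w ≠ K.concl → ρ j w ∉ F.wires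
  injContent : ∀ j < t.leaves.length, ∀ j' < t.leaves.length, ∀ w ∈ K.wires, ∀ w' ∈ K.wires,
    ρ j w = ρ j' w' → j = j' ∧ w = w'
  freshTree : ∀ i < K.prems.length, ∀ v, t.IsInner v → τ i v ∉ F.wires
  injTree : ∀ i < K.prems.length, ∀ i' < K.prems.length, ∀ v v', t.IsInner v → t.IsInner v' →
    τ i v = τ i' v' → i = i' ∧ v = v'
  apart : ∀ j < t.leaves.length, ∀ i < K.prems.length, ∀ w ∈ K.wires, ∀ v, t.IsInner v →
    ρ j w ≠ τ i v

/-- The kinds of superlazy steps; `xndw b` is an `XNDW`-step whose box has the name `b`. -/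
inductive Kind where
  | lol
  | ten
  | merge
  | xndw (b : ℕ)

/-- Superlazy reduction steps: the redex consists of nodes at level `0`.  A box keeps its name, and
so does each copy of a box, as long as no merging takes place; a merged box may get any name. -/
inductive Step : Net → Kind → Net → Prop where
  | lol {F : Net} {x b f a r : Wire} {rest : List Cell} :
      F.cells.Perm (.lolR x b f :: .lolL f a r :: rest) →
      Step F .lol (Net.rename (lolSubst x b a r) ⟨F.prems, F.concl, rest⟩)
  | ten {F : Net} {a b o x y : Wire} {rest : List Cell} :
      F.cells.Perm (.tenR a b o :: .tenL o x y :: rest) →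
      Step F .ten (Net.rename (tenSubst a b x y) ⟨F.prems, F.concl, rest⟩)
  | merge {F K L : Net} {b b' b'' : ℕ} {p u out : Wire} {aux aux₁ aux₂ Δ₁ Δ₂ : List Wire}
      {rest : List Cell} {ρ σ : Wire → Wire} :
      F.cells.Perm (.box b K.prems K.concl K.cells aux u ::
        .box b' L.prems L.concl L.cells (aux₁ ++ u :: aux₂) out :: rest) →
      L.prems = Δ₁ ++ p :: Δ₂ → Δ₁.length = aux₁.length →
      (∀ w ∈ K.wires, ∀ w' ∈ K.wires, ρ w = ρ w' → w = w') →
      (∀ w ∈ L.wires, ∀ w' ∈ L.wires, σ w = σ w' → w = w') →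
      (∀ w ∈ K.wires, ∀ w' ∈ L.wires, ρ w = σ w' ↔ w = K.concl ∧ w' = p) →
      Step F .merge ⟨F.prems, F.concl,
        .box b'' (Δ₁.map σ ++ (K.prems.map ρ ++ Δ₂.map σ)) (σ L.concl)
          (K.cells.map (Cell.rename ρ) ++ L.cells.map (Cell.rename σ))
          (aux₁ ++ (aux ++ aux₂)) out :: rest⟩
  | xndw {F K : Net} {b : ℕ} {t : Tree} {aux : List Wire} {rest : List Cell}
      {ρ τ : ℕ → Wire → Wire} :
      t.IsDerelicting →
      F.cells.Perm (.box b K.prems K.concl K.cells aux t.root :: (t.cells ++ rest)) →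
      Copying F K t aux ρ τ →
      Step F (.xndw b) ⟨F.prems, F.concl,
        (List.range K.prems.length).flatMap (fun i => t.cells.map (Cell.rename (τ i))) ++
          ((List.range t.leaves.length).flatMap (fun j => K.cells.map (Cell.rename (ρ j))) ++
            rest)⟩

/-- The relation `↪`: a superlazy step, where merging is only allowed in nets that contain no
redex of another kind. -/
def HookStep (G : Net) (κ : Kind) (H : Net) : Prop :=
  Step G κ H ∧ (κ = .merge → ∀ κ' H', Step G κ' H' → κ' = .merge)

/-- `G ↪ ⋯ ↪ H`, a sequence of steps of the listed kinds. -/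
inductive HookSeq : Net → List Kind → Net → Prop where
  | nil (G : Net) : HookSeq G [] G
  | cons {G F H : Net} {κ : Kind} {κs : List Kind} :
      HookStep G κ F → HookSeq F κs H → HookSeq G (κ :: κs) H

/-- A sequence of steps of kinds `κs` that starts in `G` is an `(n,d)`-box reduction.  The set `B`
consists of the names of the witnessing boxes at level `0` of `G`.  Here the boxes of `G` have
pairwise distinct names, so that a box met along a sequence without merging steps is a residual of
the box of `G` that has the same name. -/
def IsBoxReduction (n d : ℕ) (G : Net) (κs : List Kind) : Prop :=
  (∀ κ ∈ κs, κ ≠ Kind.merge) ∧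
  ∃ B : Finset ℕ, B.card ≤ n ∧
    (∀ b ∈ B, ∃ J, G.HasBox b J ∧ J.depth < d) ∧
    ∀ c, Kind.xndw c ∈ κs → ∃ b ∈ B, ∃ J, G.HasBox b J ∧ (c = b ∨ c ∈ J.boxNames)

/-- The functions `f_d(n,m)`. -/
def bound : ℕ → ℕ → ℕ → ℕ
  | 0, _, m => m
  | _ + 1, 0, m => m
  | d + 1, n + 1, m =>
      1 + bound (d + 1) n m +
        bound d ((2 * m + 1) * bound (d + 1) n m) ((2 * m + 1) * bound (d + 1) n m)
termination_by d n => (d, n)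

end PureNet

namespace PureNet

/-! ### The bounding functions -/

theorem bound_zero_left (d m : ℕ) : bound d 0 m = m := by
  cases d <;> simp [bound]

theorem bound_succ_succ (d n m : ℕ) :
    bound (d + 1) (n + 1) m = 1 + bound (d + 1) n m +
      bound d ((2 * m + 1) * bound (d + 1) n m) ((2 * m + 1) * bound (d + 1) n m) := by
  rw [bound]

theorem bound_mono (d : ℕ) :
    ∀ {n n' m m' : ℕ}, n ≤ n' → m ≤ m' → bound d n m ≤ bound d n' m' := by
  induction d with
  | zero => intro n n' m m' _ hm; simpa [bound] using hm
  | succ d ih =>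
    have hm : ∀ n {m m' : ℕ}, m ≤ m' → bound (d + 1) n m ≤ bound (d + 1) n m' := by
      intro n m m' h
      induction n with
      | zero => simpa [bound] using h
      | succ n ihn =>
        rw [bound_succ_succ, bound_succ_succ]
        have h' : (2 * m + 1) * bound (d + 1) n m ≤ (2 * m' + 1) * bound (d + 1) n m' := by
          gcongr
        have := ih h' h'
        omega
    have hn : ∀ m, Monotone fun n => bound (d + 1) n m := by
      intro m
      refine monotone_nat_of_le_succ fun n => ?_
      rw [bound_succ_succ]
      omega
    intro n n' m m' h h'
    exact (hm n h').trans (hn m' h)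

theorem bound_primrec (d : ℕ) : Primrec₂ (bound d) := by
  induction d with
  | zero => exact Primrec.snd.of_eq fun p => by simp [bound]
  | succ d ih =>
    let N : ℕ → ℕ × ℕ → ℕ := fun m q => (2 * m + 1) * q.2
    have hN : Primrec₂ N :=
      Primrec.nat_mul.comp
        (Primrec.succ.comp (Primrec.nat_mul.comp (Primrec.const 2) Primrec.fst))
        (Primrec.snd.comp Primrec.snd)
    have hg : Primrec₂ fun (m : ℕ) (q : ℕ × ℕ) => 1 + q.2 + bound d (N m q) (N m q) :=
      Primrec.nat_add.comp
        (Primrec.nat_add.comp (Primrec.const 1) (Primrec.snd.comp Primrec.snd))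
        (ih.comp hN hN)
    have h := (Primrec.nat_rec (f := fun m : ℕ => m) Primrec.id hg).swap
    refine h.of_eq fun n m => ?_
    simp only [Function.swap]
    induction n with
    | zero => simp [bound]
    | succ n ihn =>
      rw [bound_succ_succ]
      simp only [N, ihn]

/-! ### Skeletons

A box tree records what matters of a box for counting: the number of its premises, the number of
nodes in its content that never move out of a box, and the boxes at level `0` of its content. -/

inductive BoxTree where
  | mk (prems inert : ℕ) (kids : List BoxTree)

namespace BoxTree

mutual

def size : BoxTree → ℕ
  | mk p s kids => p + 1 + s + sizeList kids

def sizeList : List BoxTree → ℕ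
  | [] => 0
  | b :: bs => b.size + sizeList bs

end

theorem sizeList_eq_sum (bs : List BoxTree) : sizeList bs = (bs.map size).sum := by
  induction bs with
  | nil => simp [sizeList]
  | cons b bs ih => simp [sizeList, ih]

theorem one_le_size (b : BoxTree) : 1 ≤ b.size := by
  cases b; simp only [size]; omega

/-- The content of the box has depth less than `d`. -/
def ContentDepthLT : ℕ → BoxTree → Prop
  | 0, _ => False
  | d + 1, mk _ _ kids => ∀ b ∈ kids, ContentDepthLT d b

theorem ContentDepthLT.succ {d : ℕ} {b : BoxTree} (h : ContentDepthLT d b) :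
    ContentDepthLT (d + 1) b := by
  induction d generalizing b with
  | zero => exact h.elim
  | succ d ih =>
    cases b with
    | mk p s kids => exact fun c hc => ih (h c hc)

end BoxTree

/-- The total size of the boxes in a multiset. -/
def boxSize (L : Multiset BoxTree) : ℕ := (L.map BoxTree.size).sum

theorem boxSize_add (L M : Multiset BoxTree) : boxSize (L + M) = boxSize L + boxSize M := by
  simp [boxSize]

theorem boxSize_cons (b : BoxTree) (L : Multiset BoxTree) :
    boxSize (b ::ₘ L) = b.size + boxSize L := by
  simp [boxSize]

theorem boxSize_nsmul (n : ℕ) (L : Multiset BoxTree) : boxSize (n • L) = n * boxSize L := by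
  simp [boxSize, Multiset.map_nsmul, Multiset.sum_nsmul]

theorem boxSize_coe (L : List BoxTree) : boxSize L = BoxTree.sizeList L := by
  simp [boxSize, BoxTree.sizeList_eq_sum]

theorem card_le_boxSize (L : Multiset BoxTree) : L.card ≤ boxSize L := by
  induction L using Multiset.induction with
  | empty => simp
  | cons b L ih =>
    have := b.one_le_size
    rw [boxSize_cons, Multiset.card_cons]
    omega

/-- The skeleton of a step on a net with a number of inert nodes and a multiset of boxes: an inert
node disappears, or a box that faces a tree of `t` nodes with `l ≤ t` leaves is opened. -/
inductive SkelStep : ℕ × Multiset BoxTree → ℕ × Multiset BoxTree → Prop where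
  | erase {s s' : ℕ} (L : Multiset BoxTree) : s' < s → SkelStep (s, L) (s', L)
  | opening (s p c : ℕ) {t l : ℕ} (kids : List BoxTree) (L : Multiset BoxTree) : l ≤ t →
      SkelStep (s + t, .mk p c kids ::ₘ L) (s + p * t + l * c, L + l • (kids : Multiset BoxTree))

/-- Sequences of a given number of skeleton steps. -/
inductive SkelRun : ℕ × Multiset BoxTree → ℕ → ℕ × Multiset BoxTree → Prop where
  | refl (σ : ℕ × Multiset BoxTree) : SkelRun σ 0 σ
  | tail {σ τ υ : ℕ × Multiset BoxTree} {k : ℕ} :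
      SkelRun σ k τ → SkelStep τ υ → SkelRun σ (k + 1) υ

theorem SkelRun.head {σ τ υ : ℕ × Multiset BoxTree} {k : ℕ} (h : SkelStep σ τ)
    (r : SkelRun τ k υ) : SkelRun σ (k + 1) υ := by
  induction r with
  | refl => exact (SkelRun.refl _).tail h
  | tail _ h' ih => exact ih.tail h'

theorem SkelStep.contentDepthLT {σ τ : ℕ × Multiset BoxTree} {d : ℕ} (h : SkelStep σ τ)
    (hσ : ∀ b ∈ σ.2, BoxTree.ContentDepthLT d b) : ∀ b ∈ τ.2, BoxTree.ContentDepthLT d b := by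
  cases h with
  | erase L _ => exact hσ
  | opening s p c kids L _ =>
    intro b hb
    rcases Multiset.mem_add.1 hb with hb | hb
    · exact hσ b (Multiset.mem_cons_of_mem hb)
    · have hb' : b ∈ kids := by simpa using Multiset.mem_of_mem_nsmul hb
      have := hσ _ (Multiset.mem_cons_self _ _)
      cases d with
      | zero => exact this.elim
      | succ d => exact BoxTree.ContentDepthLT.succ (this b hb')

theorem SkelRun.contentDepthLT {σ τ : ℕ × Multiset BoxTree} {d k : ℕ} (r : SkelRun σ k τ)
    (hσ : ∀ b ∈ σ.2, BoxTree.ContentDepthLT d b) : ∀ b ∈ τ.2, BoxTree.ContentDepthLT d b := by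
  induction r with
  | refl => exact hσ
  | tail _ h ih => exact h.contentDepthLT ih

theorem SkelRun.add_le_of_no_box {σ τ : ℕ × Multiset BoxTree} {k : ℕ} (r : SkelRun σ k τ)
    (hσ : σ.2 = 0) : τ.2 = 0 ∧ k + τ.1 ≤ σ.1 := by
  induction r with
  | refl => exact ⟨hσ, by simp⟩
  | tail _ h ih =>
    obtain ⟨h0, hk⟩ := ih
    cases h with
    | erase L h => exact ⟨h0, by simp only at hk ⊢; omega⟩
    | opening s p c kids L _ => simp at h0

theorem opening_size_le {m S s t l p c K R Q b : ℕ} (hl : l ≤ t) (hb : b ≤ m)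
    (hbox : b = p + 1 + c + K) (hS : s + t + Q + b + R ≤ S) :
    s + p * t + l * c + Q + (R + l * K) ≤ (2 * m + 1) * S := by
  have h1 : p * t ≤ m * S := Nat.mul_le_mul (by omega) (by omega)
  have h2 : l * (c + K) ≤ S * m := Nat.mul_le_mul (by omega) (by omega)
  nlinarith

/-- A stage `σ` of a run, after `k` steps from a state with `n` boxes of size at most `m`: `i` of
these boxes have been opened, the last one in step `k₁`, and those in `Q` remain.  The `k₂` steps
since then have turned the other boxes `F` into `R`; seen as a run on these alone, it treats the
nodes of the boxes in `Q` as inert, and `f` is the number of inert nodes at its start. -/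
structure Stage (d m n k : ℕ) (σ : ℕ × Multiset BoxTree) (Q R F : Multiset BoxTree)
    (i k₁ k₂ f : ℕ) : Prop where
  boxes : σ.2 = Q + R
  count : i + Q.card = n
  steps : k = k₁ + k₂
  oldSize : ∀ b ∈ Q, b.size ≤ m
  oldDepth : ∀ b ∈ Q, BoxTree.ContentDepthLT (d + 1) b
  newDepth : ∀ b ∈ F, BoxTree.ContentDepthLT d b
  run : SkelRun (f, F) k₂ (σ.1 + boxSize Q, R)
  le : k₁ + bound d F.card (f + boxSize F) ≤ bound (d + 1) i m

theorem Stage.step {d m n k : ℕ} {σ τ : ℕ × Multiset BoxTree} {Q R F : Multiset BoxTree}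
    {i k₁ k₂ f : ℕ}
    (ih : ∀ {σ τ : ℕ × Multiset BoxTree} {k : ℕ}, SkelRun σ k τ →
      (∀ b ∈ σ.2, BoxTree.ContentDepthLT d b) →
      k ≤ bound d σ.2.card (σ.1 + boxSize σ.2) ∧
        τ.1 + boxSize τ.2 ≤ bound d σ.2.card (σ.1 + boxSize σ.2))
    (h : Stage d m n k σ Q R F i k₁ k₂ f) (hs : SkelStep σ τ) :
    ∃ Q R F i k₁ k₂ f, Stage d m n (k + 1) τ Q R F i k₁ k₂ f := by
  cases hs with
  | @erase s s' L hlt =>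
    refine ⟨Q, R, F, i, k₁, k₂ + 1, f, h.boxes, h.count, ?_, h.oldSize, h.oldDepth, h.newDepth,
      h.run.tail (.erase _ ?_), h.le⟩
    · have := h.steps; omega
    · simpa using hlt
  | @opening s p c t l kids L hl =>
    have hmem : BoxTree.mk p c kids ∈ Q + R := by
      rw [← h.boxes]; exact Multiset.mem_cons_self _ _
    have hbox := h.boxes
    rcases Multiset.mem_add.1 hmem with hQ | hR
    · obtain ⟨Q', rfl⟩ := Multiset.exists_cons_of_mem hQ
      rw [Multiset.cons_add, Multiset.cons_inj_right] at hbox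
      obtain ⟨hk₂, hsize⟩ := ih h.run h.newDepth
      have hle := h.le
      have hN := opening_size_le (m := m) (S := bound (d + 1) i m) (s := s) (t := t) (l := l)
        (p := p) (c := c) (K := BoxTree.sizeList kids) (R := boxSize R) (Q := boxSize Q')
        (b := (BoxTree.mk p c kids).size) hl (h.oldSize _ (Multiset.mem_cons_self _ _))
        (by simp [BoxTree.size]) (by rw [boxSize_cons] at hsize; simp only at hsize; omega)
      have hF : boxSize (R + l • (kids : Multiset BoxTree)) =
          boxSize R + l * BoxTree.sizeList kids := by
        rw [boxSize_add, boxSize_nsmul, boxSize_coe]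
      refine ⟨Q', R + l • (kids : Multiset BoxTree), R + l • (kids : Multiset BoxTree), i + 1,
        k + 1, 0, s + p * t + l * c + boxSize Q', ?_, ?_, rfl,
        fun b hb => h.oldSize b (Multiset.mem_cons_of_mem hb),
        fun b hb => h.oldDepth b (Multiset.mem_cons_of_mem hb), ?_, .refl _, ?_⟩
      · simp only [hbox, add_assoc]
      · have := h.count
        rw [Multiset.card_cons] at this
        omega
      · intro b hb
        rcases Multiset.mem_add.1 hb with hb | hb
        · exact h.run.contentDepthLT h.newDepth b hb
        · exact h.oldDepth _ (Multiset.mem_cons_self _ _) b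
            (by simpa using Multiset.mem_of_mem_nsmul hb)
      · have hcard := card_le_boxSize (R + l • (kids : Multiset BoxTree))
        have := bound_mono d (n := (R + l • (kids : Multiset BoxTree)).card)
          (n' := (2 * m + 1) * bound (d + 1) i m)
          (m := s + p * t + l * c + boxSize Q' + boxSize (R + l • (kids : Multiset BoxTree)))
          (m' := (2 * m + 1) * bound (d + 1) i m) (by omega) (by omega)
        have hk := h.steps
        simp only at hk₂
        rw [bound_succ_succ]
        omega
    · obtain ⟨R', rfl⟩ := Multiset.exists_cons_of_mem hR
      rw [Multiset.add_cons, Multiset.cons_inj_right] at hbox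
      have hrun := h.run
      simp only [show s + t + boxSize Q = s + boxSize Q + t by omega] at hrun
      have hrun' := hrun.tail (.opening (s + boxSize Q) p c kids R' hl)
      rw [show s + boxSize Q + p * t + l * c = s + p * t + l * c + boxSize Q by omega] at hrun'
      exact ⟨Q, R' + l • (kids : Multiset BoxTree), F, i, k₁, k₂ + 1, f,
        by simp only [hbox, add_assoc], h.count, by have := h.steps; omega, h.oldSize, h.oldDepth,
        h.newDepth, hrun', h.le⟩

/-- A run that starts with `n` boxes whose contents have depth less than `d` obeys the bound
`f_d(n,m)`, where `m` is the size of its start. -/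
theorem SkelRun.le_bound {d : ℕ} : ∀ {σ τ : ℕ × Multiset BoxTree} {k : ℕ}, SkelRun σ k τ →
    (∀ b ∈ σ.2, BoxTree.ContentDepthLT d b) →
    k ≤ bound d σ.2.card (σ.1 + boxSize σ.2) ∧
      τ.1 + boxSize τ.2 ≤ bound d σ.2.card (σ.1 + boxSize σ.2) := by
  induction d with
  | zero =>
    intro σ τ k r hσ
    have h0 : σ.2 = 0 := Multiset.eq_zero_of_forall_notMem fun b hb => hσ b hb
    obtain ⟨h1, h2⟩ := r.add_le_of_no_box h0
    simp only [bound, h0, h1, boxSize, Multiset.map_zero, Multiset.sum_zero]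
    omega
  | succ d ih =>
    intro σ τ k r hσ
    obtain ⟨Q, R, F, i, k₁, k₂, f, h⟩ : ∃ Q R F i k₁ k₂ f,
        Stage d (σ.1 + boxSize σ.2) σ.2.card k τ Q R F i k₁ k₂ f := by
      induction r with
      | refl =>
        refine ⟨σ.2, 0, 0, 0, 0, 0, σ.1 + boxSize σ.2, by simp, by simp, rfl, ?_, hσ, by simp,
          .refl _, ?_⟩
        · intro b hb
          obtain ⟨L, hL⟩ := Multiset.exists_cons_of_mem hb
          rw [hL, boxSize_cons]
          omega
        · simp [bound_zero_left, boxSize]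
      | tail _ hs ihr =>
        obtain ⟨Q, R, F, i, k₁, k₂, f, h⟩ := ihr
        exact h.step ih hs
    obtain ⟨hk₂, hsize⟩ := ih h.run h.newDepth
    have hle := h.le
    have hk := h.steps
    have hmono := bound_mono (d + 1) (n := i) (n' := σ.2.card) (by have := h.count; omega)
      (le_refl (σ.1 + boxSize σ.2))
    rw [h.boxes, boxSize_add]
    simp only at hk₂ hsize
    omega

/-! ### From nets to skeletons -/

namespace Cell

open Classical in
mutual

/-- The inert nodes of a cell and its boxes, where boxes whose name is not in `A` count as inert. -/
noncomputable def skel (A : Set ℕ) : Cell → ℕ × List BoxTree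
  | box b ps c cs as o =>
    if b ∈ A then (0, [.mk ps.length (skelList A cs).1 (skelList A cs).2])
    else ((box b ps c cs as o).size, [])
  | _ => (1, [])

noncomputable def skelList (A : Set ℕ) : List Cell → ℕ × List BoxTree
  | [] => (0, [])
  | c :: cs => ((skel A c).1 + (skelList A cs).1, (skel A c).2 ++ (skelList A cs).2)

end

theorem skel_box_of_mem {A : Set ℕ} {b : ℕ} (hb : b ∈ A) (ps : List Wire) (c : Wire)
    (cs : List Cell) (as : List Wire) (o : Wire) :
    skel A (.box b ps c cs as o) =
      (0, [.mk ps.length (skelList A cs).1 (skelList A cs).2]) := by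
  simp [skel, hb]

theorem skel_box_of_notMem {A : Set ℕ} {b : ℕ} (hb : b ∉ A) (ps : List Wire) (c : Wire)
    (cs : List Cell) (as : List Wire) (o : Wire) :
    skel A (.box b ps c cs as o) = ((Cell.box b ps c cs as o).size, []) := by
  simp [skel, hb]

theorem skel_rename (A : Set ℕ) (σ : Wire → Wire) (c : Cell) :
    skel A (c.rename σ) = skel A c := by
  cases c <;> simp [rename, skel, size]

mutual

theorem skel_size (A : Set ℕ) : ∀ c : Cell,
    (skel A c).1 + BoxTree.sizeList (skel A c).2 = c.size
  | box b ps c cs as o => by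
    by_cases hb : b ∈ A
    · have := skelList_size A cs
      simp only [skel_box_of_mem hb, BoxTree.sizeList, BoxTree.size, size]
      omega
    · simp [skel_box_of_notMem hb, BoxTree.sizeList]
  | weak _ | contr _ _ _ | der _ _ | dig _ _ | lolR _ _ _ | lolL _ _ _ | tenR _ _ _
  | tenL _ _ _ => by simp [skel, size, BoxTree.sizeList]

theorem skelList_size (A : Set ℕ) : ∀ cs : List Cell,
    (skelList A cs).1 + BoxTree.sizeList (skelList A cs).2 = sizeList cs
  | [] => by simp [skelList, BoxTree.sizeList, sizeList]
  | c :: cs => by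
    have h1 := skel_size A c
    have h2 := skelList_size A cs
    simp only [skelList, sizeList, BoxTree.sizeList_eq_sum, List.map_append, List.sum_append]
      at h1 h2 ⊢
    omega

end

mutual

theorem skel_contentDepthLT (A : Set ℕ) : ∀ (c : Cell) (d : ℕ), c.depth ≤ d →
    ∀ t ∈ (skel A c).2, BoxTree.ContentDepthLT d t
  | box b ps c cs as o, d, hd, t, ht => by
    by_cases hb : b ∈ A
    · rw [skel_box_of_mem hb, List.mem_singleton] at ht
      subst ht
      cases d with
      | zero => simp [depth] at hd
      | succ d => exact skelList_contentDepthLT A cs d (by simpa [depth] using hd)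
    · simp [skel_box_of_notMem hb] at ht
  | weak _, _, _, _, ht | contr _ _ _, _, _, _, ht | der _ _, _, _, _, ht
  | dig _ _, _, _, _, ht | lolR _ _ _, _, _, _, ht | lolL _ _ _, _, _, _, ht
  | tenR _ _ _, _, _, _, ht | tenL _ _ _, _, _, _, ht => by simp [skel] at ht

theorem skelList_contentDepthLT (A : Set ℕ) : ∀ (cs : List Cell) (d : ℕ), depthList cs ≤ d →
    ∀ t ∈ (skelList A cs).2, BoxTree.ContentDepthLT d t
  | [], _, _, t, ht => by simp [skelList] at ht
  | c :: cs, d, hd, t, ht => by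
    simp only [depthList, sup_le_iff] at hd
    rcases List.mem_append.1 (by simpa [skelList] using ht) with ht | ht
    · exact skel_contentDepthLT A c d hd.1 t ht
    · exact skelList_contentDepthLT A cs d hd.2 t ht

end

theorem mem_skelList {A : Set ℕ} {cs : List Cell} {t : BoxTree} :
    t ∈ (skelList A cs).2 ↔ ∃ c ∈ cs, t ∈ (skel A c).2 := by
  induction cs with
  | nil => simp [skelList]
  | cons c cs ih => simp [skelList, ih]

/-- The skeleton of the cells of a net, where the order of boxes is forgotten. -/
noncomputable def multiSkel (A : Set ℕ) (cs : List Cell) : ℕ × Multiset BoxTree :=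
  (cs.map fun c => ((skel A c).1, ((skel A c).2 : Multiset BoxTree))).sum

theorem multiSkel_nil (A : Set ℕ) : multiSkel A [] = 0 := rfl

theorem multiSkel_cons (A : Set ℕ) (c : Cell) (cs : List Cell) :
    multiSkel A (c :: cs) =
      ((skel A c).1, ((skel A c).2 : Multiset BoxTree)) + multiSkel A cs := by
  simp [multiSkel]

theorem multiSkel_append (A : Set ℕ) (cs ds : List Cell) :
    multiSkel A (cs ++ ds) = multiSkel A cs + multiSkel A ds := by
  simp [multiSkel]

theorem multiSkel_perm (A : Set ℕ) {cs ds : List Cell} (h : cs.Perm ds) :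
    multiSkel A cs = multiSkel A ds :=
  (h.map _).sum_eq

theorem multiSkel_rename (A : Set ℕ) (σ : Wire → Wire) (cs : List Cell) :
    multiSkel A (cs.map (rename σ)) = multiSkel A cs := by
  simp [multiSkel, Function.comp_def, skel_rename]

theorem multiSkel_copies (A : Set ℕ) (σ : ℕ → Wire → Wire) (cs : List Cell) (n : ℕ) :
    multiSkel A ((List.range n).flatMap fun j => cs.map (rename (σ j))) = n • multiSkel A cs := by
  induction n with
  | zero => simp [multiSkel_nil]
  | succ n ih =>
    rw [List.range_succ, List.flatMap_append, multiSkel_append, ih, succ_nsmul]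
    simp [multiSkel_rename]

theorem multiSkel_eq (A : Set ℕ) (cs : List Cell) :
    multiSkel A cs = ((skelList A cs).1, ((skelList A cs).2 : Multiset BoxTree)) := by
  induction cs with
  | nil => simp [multiSkel_nil, skelList]; rfl
  | cons c cs ih => rw [multiSkel_cons, ih]; simp [skelList]

end Cell

namespace Tree

theorem multiSkel_cells (A : Set ℕ) (t : Tree) :
    Cell.multiSkel A t.cells = (t.cells.length, 0) := by
  induction t with
  | contr i t s iht ihs =>
    simp [cells, Cell.multiSkel_cons, Cell.multiSkel_append, iht, ihs, Cell.skel]; omega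
  | _ => simp_all [cells, Cell.multiSkel_cons, Cell.multiSkel_nil, Cell.skel, add_comm]

theorem length_leaves_le (t : Tree) : t.leaves.length ≤ t.cells.length := by
  induction t <;> simp [leaves, cells] <;> omega

end Tree

/-- The skeleton of a net. -/
noncomputable def Net.skel (A : Set ℕ) (G : Net) : ℕ × Multiset BoxTree :=
  (G.prems.length + 1, 0) + Cell.multiSkel A G.cells

theorem Net.skel_size (A : Set ℕ) (G : Net) :
    (G.skel A).1 + boxSize (G.skel A).2 = G.size := by
  have := Cell.skelList_size A G.cells
  simp only [Net.skel, Cell.multiSkel_eq, Prod.mk_add_mk, zero_add, boxSize_coe, Net.size]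
  omega

theorem Step.skelStep {A : Set ℕ} {F H : Net} {κ : Kind} (h : Step F κ H) (hm : κ ≠ .merge)
    (hA : ∀ b, κ = .xndw b → b ∈ A) : SkelStep (F.skel A) (H.skel A) := by
  cases h with
  | lol hp | ten hp =>
    simp only [Net.skel, Net.rename, Cell.multiSkel_perm A hp, Cell.multiSkel_cons,
      Cell.multiSkel_rename, Cell.skel, List.length_map]
    obtain ⟨s, L⟩ := Cell.multiSkel A _
    simp only [Prod.mk_add_mk, Multiset.coe_nil, zero_add]
    exact .erase _ (by omega)
  | merge => exact (hm rfl).elim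
  | @xndw K b t aux rest ρ τ _ hp _ =>
    simp only [Net.skel, Cell.multiSkel_perm A hp, Cell.multiSkel_cons, Cell.multiSkel_append,
      Cell.multiSkel_copies, Tree.multiSkel_cells, Cell.skel_box_of_mem (hA b rfl),
      Cell.multiSkel_eq A K.cells]
    obtain ⟨s, L⟩ := Cell.multiSkel A rest
    simp only [Prod.mk_add_mk, Prod.smul_mk, smul_zero, zero_add, smul_eq_mul]
    convert SkelStep.opening (F.prems.length + 1 + s) K.prems.length (Cell.skelList A K.cells).1
      (Cell.skelList A K.cells).2 L t.length_leaves_le using 2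
    · omega
    · exact Multiset.singleton_add _ _
    · ring
    · exact add_comm _ _

theorem HookSeq.skelRun {A : Set ℕ} {G H : Net} {κs : List Kind} (h : HookSeq G κs H)
    (hm : ∀ κ ∈ κs, κ ≠ Kind.merge) (hA : ∀ b, Kind.xndw b ∈ κs → b ∈ A) :
    SkelRun (G.skel A) κs.length (H.skel A) := by
  induction h with
  | nil => exact .refl _
  | cons hs _ ih =>
    exact SkelRun.head
      (hs.1.skelStep (hm _ List.mem_cons_self)
        fun b hb => hA b (hb ▸ List.mem_cons_self))
      (ih (fun κ hκ => hm κ (List.mem_cons_of_mem _ hκ))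
        fun b hb => hA b (List.mem_cons_of_mem _ hb))

/-! ### Boxes with distinct names -/

namespace Cell

theorem boxNamesList_eq_flatMap (cs : List Cell) : boxNamesList cs = cs.flatMap boxNames := by
  induction cs with
  | nil => simp [boxNamesList]
  | cons c cs ih => simp [boxNamesList, ih]

theorem eq_of_mem_boxNames {cs : List Cell} (h : (boxNamesList cs).Nodup) {c c' : Cell} {b : ℕ}
    (hc : c ∈ cs) (hc' : c' ∈ cs) (hb : b ∈ c.boxNames) (hb' : b ∈ c'.boxNames) : c = c' := by
  rw [boxNamesList_eq_flatMap, List.nodup_flatMap] at h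
  by_contra hne
  have : Std.Symm (Function.onFun List.Disjoint boxNames) :=
    ⟨fun _ _ h => List.Disjoint.symm h⟩
  exact h.2.forall hc hc' hne hb hb'

/-- If the boxes in `cs` have distinct names and those at level `0` that are in `A` have their names
in `B`, then there are at most `B.card` of these. -/
theorem length_skelList_le (A : Set ℕ) {cs : List Cell} (h : (boxNamesList cs).Nodup)
    {B : Finset ℕ} (hB : ∀ b ps c ks as o, Cell.box b ps c ks as o ∈ cs → b ∈ A → b ∈ B) :
    (skelList A cs).2.length ≤ B.card := by
  induction cs generalizing B with
  | nil => simp [skelList]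
  | cons x cs ih =>
    have hx := h
    rw [boxNamesList, List.nodup_append'] at hx
    have hcs := ih (B := B) hx.2.1 fun b ps c ks as o hb =>
      hB b ps c ks as o (List.mem_cons_of_mem _ hb)
    cases x with
    | box b ps c ks as o =>
      by_cases hb : b ∈ A
      · have hbB := hB b ps c ks as o List.mem_cons_self hb
        have hcs' := ih (B := B.erase b) hx.2.1 fun b' ps' c' ks' as' o' hb' hA => by
          refine Finset.mem_erase.2 ⟨?_, hB b' ps' c' ks' as' o' (List.mem_cons_of_mem _ hb') hA⟩
          rintro rfl
          have hmem : b' ∈ boxNamesList cs := by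
            rw [boxNamesList_eq_flatMap, List.mem_flatMap]
            exact ⟨_, hb', by simp [boxNames]⟩
          exact hx.2.2 (by simp [boxNames]) hmem
        have := Finset.card_erase_add_one hbB
        simp only [skelList, skel_box_of_mem hb, List.length_append, List.length_singleton]
        omega
      · simpa [skelList, skel_box_of_notMem hb] using hcs
    | _ => simpa [skelList, skel] using hcs

end Cell

end PureNet

theorem mainTheorem3 :
    (∀ d : ℕ, Primrec₂ (PureNet.bound d)) ∧
    ∀ (n d k : ℕ) (G H : PureNet.Net) (κs : List PureNet.Kind),
      PureNet.IsProofNet G → G.boxNames.Nodup →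
      PureNet.HookSeq G κs H → κs.length = k → PureNet.IsBoxReduction n d G κs →
      k ≤ PureNet.bound d n G.size ∧ H.size ≤ PureNet.bound d n G.size := by
  refine ⟨PureNet.bound_primrec, ?_⟩
  rintro n d k G H κs - hnodup hseq rfl ⟨hmerge, B, hcard, hB, hκ⟩
  let A : Set ℕ := {c | ∃ b ∈ B, ∃ J, G.HasBox b J ∧ (c = b ∨ c ∈ J.boxNames)}
  have htop : ∀ b ps c ks as o, PureNet.Cell.box b ps c ks as o ∈ G.cells → b ∈ A → b ∈ B := by
    rintro b ps c ks as o hmem ⟨b', hb', J, ⟨aux, out, hJ⟩, rfl | hin⟩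
    · exact hb'
    · have := PureNet.Cell.eq_of_mem_boxNames hnodup hmem hJ (b := b)
        (by simp [PureNet.Cell.boxNames])
        (by rw [PureNet.Cell.boxNames]; exact List.mem_cons_of_mem _ hin)
      cases this
      exact hb'
  have hdepth : ∀ t ∈ (G.skel A).2, PureNet.BoxTree.ContentDepthLT d t := by
    intro t ht
    simp only [PureNet.Net.skel, PureNet.Cell.multiSkel_eq, Prod.snd_add, zero_add,
      Multiset.mem_coe, PureNet.Cell.mem_skelList] at ht
    obtain ⟨x, hx, ht⟩ := ht
    cases x with
    | box b ps c cs as o =>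
      by_cases hb : b ∈ A
      · obtain ⟨J, ⟨aux, out, hJ⟩, hd⟩ := hB b (htop b ps c cs as o hx hb)
        have := PureNet.Cell.eq_of_mem_boxNames hnodup hx hJ (b := b)
          (by simp [PureNet.Cell.boxNames]) (by simp [PureNet.Cell.boxNames])
        cases this
        exact PureNet.Cell.skel_contentDepthLT A _ d
          (by simpa [PureNet.Cell.depth, PureNet.Net.depth, Nat.succ_le_iff] using hd) t ht
      · simp [PureNet.Cell.skel_box_of_notMem hb] at ht
    | _ => simp [PureNet.Cell.skel] at ht
  have hlen : (G.skel A).2.card ≤ n := by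
    have := PureNet.Cell.length_skelList_le A hnodup htop
    simp only [PureNet.Net.skel, PureNet.Cell.multiSkel_eq, Prod.snd_add, zero_add,
      Multiset.coe_card]
    exact this.trans hcard
  obtain ⟨h₁, h₂⟩ := (hseq.skelRun (A := A) hmerge hκ).le_bound hdepth
  rw [G.skel_size] at h₁ h₂
  rw [H.skel_size] at h₂
  have := PureNet.bound_mono d hlen (le_refl G.size)
  exact ⟨h₁.trans this, h₂.trans this⟩
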